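/- Let $a,b,c,\alpha,\beta,\gamma$ be non-negative integers with $\alpha<a$, $\beta<b$, $\gamma<c$, at most one of $\alpha,\beta,\gamma$ equal to $0$, and $a+b+c+\alpha+\beta+\gamma\equiv 0 \pmod 3$. Put $$s=\tfrac13(a+b+c+\alpha+\beta+\gamma)-2,\quad A=s+2-a,\quad B=s+2-b,\quad C=s+2-c,\quad M=s+2-(\alpha+\beta+\gamma),$$ and assume $0\le M$, $0\le A\le\beta+\gamma$, $0\le B\le\alpha+\gamma$ and $0\le C\le\alpha+\beta$. **The punctured hexagon.** Take an equilateral triangle of side length $s+2$ with barycentric coordinates $u,v,w\ge 0$, $u+v+w=s+2$, whose vertices $u=s+2$, $v=s+2$, $w=s+2$ lie at the bottom, at the upper right and at the upper left, and divide it into unit triangles by the lines on which $u$, $v$ or $w$ is an integer. The punctured hexagon $H=H_{a,b,c,\alpha,\beta,\gamma}$ is the region made of the unit triangles contained in $\{u\le a,\ v\le b,\ w\le c\}$ but not contained in the puncture $\{u\ge\alpha,\ v\ge\beta,\ w\ge\gamma\}$. Equivalently, the upward (downward) pointing unit triangles of $H$ correspond to the monomials $x^iy^jz^k$ of degree $s$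 (of degree $s+1$) that do not lie in the ideal $(x^a,y^b,z^c,x^\alpha y^\beta z^\gamma)$, where $x^iy^jz^k$ stands for the triangle $i\le u\le i+1$, $j\le v\le j+1$, $k\le w\le k+1$. The hexagon has side lengths $A,B+M,C,A+M,B,C+M$ (clockwise from the bottom) and the puncture is an equilateral triangle of side length $M$. A lozenge is the union of two unit triangles that share an edge; a lozenge tiling of $H$ is a set of lozenges contained in $H$ such that every unit triangle of $H$ lies in exactly one of them. **The associated lattice paths.** Mark the midpoints of all unit edges parallel to the side of $H$ of length $C$ (the side $w=c$). Give the marked point on the edge of the unit triangle $i\le u\le i+1$, $j\le v\le j+1$, $k\le w\le k+1$ the coordinates $(j,\ a-1-i)\in\mathbb Z^2$; thus motion parallel to the side of length $A$ is horizontal and motion parallel to the side of length $B$ is vertical. In these coordinates the marked points on the side of length $C$, those on the puncture edge parallel to it, and those on the side of length $C+M$ are, respectively, $$A_i=(i-1,\,B+M+i-1)\ (1\le i\le C),\qquad A_i=(\beta+i-C-1,\,B-\alpha+i-1)\ (C+1\le i\le C+M),$$ $$E_j=(A+j-1,\,j-1)\ (1\le j\le C+M).$$ A lattice path is a sequence of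 lattice points in which each step is $(1,0)$ or $(0,-1)$ (a single point is allowed). A family of non-intersecting lattice paths consists of a permutation $\lambda\in\mathfrak S_{C+M}$ and, for each $i$, a lattice path from $A_i$ to $E_{\lambda(i)}$, such that no two of the paths have a lattice point in common; its sign is $\operatorname{sgn}\lambda$. A family is associated to a lozenge tiling $T$ if the unit steps of its paths are exactly the segments that connect the two marked points of those lozenges of $T$ that contain two marked points. **Theorem.** To every lozenge tiling $T$ of $H$ there is associated exactly one family $L_T$ of non-intersecting lattice paths, and $$\det N_{a,b,c,\alpha,\beta,\gamma}=\sum_{T}\operatorname{sgn}(L_T),$$ where $T$ runs over all lozenge tilings of $H$ and $N=N_{a,b,c,\alpha,\beta,\gamma}$ is the square integer matrix of size $C+M$ with entries $$N_{i,j}=\begin{cases}\dbinom{c}{A+j-i} & 1\le i\le C,\\[1em] \dbinom{\gamma}{A+C-\beta+j-i} & C+1\le i\le C+M,\end{cases}$$ with $\binom nk=0$ for $k<0$ or $k>n$, and the determinant of the empty matrix is $1$. -/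

import Mathlib

/-- The six parameters `(a, b, c, α, β, γ)` of a punctured hexagon. -/
structure HexParams where
  a : ℕ
  b : ℕ
  c : ℕ
  α : ℕ
  β : ℕ
  γ : ℕ

namespace HexParams

/-- The number `s + 2 = (a + b + c + α + β + γ) / 3`
(an exact division for admissible parameters). -/
def S (p : HexParams) : ℕ := (p.a + p.b + p.c + p.α + p.β + p.γ) / 3

/-- `A = s + 2 - a` (no truncation for admissible parameters). -/
def A (p : HexParams) : ℕ := p.S - p.a

/-- `B = s + 2 - b` (no truncation for admissible parameters). -/
def B (p : HexParams) : ℕ := p.S - p.b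

/-- `C = s + 2 - c` (no truncation for admissible parameters). -/
def C (p : HexParams) : ℕ := p.S - p.c

/-- `M = s + 2 - (α + β + γ)` (no truncation for admissible parameters). -/
def M (p : HexParams) : ℕ := p.S - (p.α + p.β + p.γ)

/-- The conditions on the parameters of a punctured hexagon. -/
structure Admissible (p : HexParams) : Prop where
  α_lt : p.α < p.a
  β_lt : p.β < p.b
  γ_lt : p.γ < p.c
  /-- At most one of `α`, `β`, `γ` is zero. -/
  α_β_ne : p.α ≠ 0 ∨ p.β ≠ 0
  α_γ_ne : p.α ≠ 0 ∨ p.γ ≠ 0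
  β_γ_ne : p.β ≠ 0 ∨ p.γ ≠ 0
  three_dvd : 3 ∣ p.a + p.b + p.c + p.α + p.β + p.γ
  /-- `0 ≤ M`, written without subtraction. -/
  M_nonneg : p.α + p.β + p.γ ≤ p.S
  /-- `0 ≤ A`, written without subtraction. -/
  A_nonneg : p.a ≤ p.S
  A_le : p.A ≤ p.β + p.γ
  /-- `0 ≤ B`, written without subtraction. -/
  B_nonneg : p.b ≤ p.S
  B_le : p.B ≤ p.α + p.γ
  /-- `0 ≤ C`, written without subtraction. -/
  C_nonneg : p.c ≤ p.S
  C_le : p.C ≤ p.α + p.β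

/-- The binomial coefficient `n` over `k` with an integer lower index; it is `0` for `k < 0`
(and for `k > n`). -/
def binom (n : ℕ) (k : ℤ) : ℤ := if 0 ≤ k then (n.choose k.toNat : ℤ) else 0

/-- The binomial matrix `N`. Rows and columns are numbered from `0` here, which does not change
`j - i`; the rows `1 ≤ i ≤ C` are the ones with `(i : ℕ) < C`. -/
def N (p : HexParams) : Matrix (Fin (p.C + p.M)) (Fin (p.C + p.M)) ℤ :=
  Matrix.of fun i j =>
    if (i : ℕ) < p.C then binom p.c ((p.A : ℤ) + (j : ℕ) - (i : ℕ))
    else binom p.γ ((p.A : ℤ) + p.C - p.β + (j : ℕ) - (i : ℕ))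

/-- A unit triangle, labelled by the exponents `(i, j, k)` of a monomial `x^i y^j z^k`.

In the equilateral triangle of side length `s + 2`, with barycentric coordinates
`u, v, w ≥ 0`, `u + v + w = s + 2` (the vertex with `u = s + 2` at the bottom, the one with
`v = s + 2` at the upper right, the one with `w = s + 2` at the upper left), the label `(i, j, k)`
stands for the unit triangle `i ≤ u ≤ i + 1`, `j ≤ v ≤ j + 1`, `k ≤ w ≤ k + 1`. It points up if
`i + j + k = s` and down if `i + j + k = s + 1`. -/
abbrev Cell : Type := ℕ × ℕ × ℕ

/-- The unit triangles of the box `u ≤ a`, `v ≤ b`, `w ≤ c` outside the puncture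
`u ≥ α`, `v ≥ β`, `w ≥ γ`; that is, the monomials that are divisible by none of
`x^a`, `y^b`, `z^c`, `x^α y^β z^γ`. -/
def cells (p : HexParams) : Finset Cell :=
  (Finset.range p.a ×ˢ Finset.range p.b ×ˢ Finset.range p.c).filter fun t =>
    ¬ (p.α ≤ t.1 ∧ p.β ≤ t.2.1 ∧ p.γ ≤ t.2.2)

/-- The upward pointing unit triangles of the punctured hexagon (monomials of degree `s`). -/
def upCells (p : HexParams) : Finset Cell :=
  p.cells.filter fun t => t.1 + t.2.1 + t.2.2 + 2 = p.S

/-- The downward pointing unit triangles of the punctured hexagon (monomials of degree `s + 1`). -/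
def downCells (p : HexParams) : Finset Cell :=
  p.cells.filter fun t => t.1 + t.2.1 + t.2.2 + 1 = p.S

/-- The upward pointing triangle `m` and the downward pointing triangle `n` share an edge. -/
def Adjacent (m n : Cell) : Prop :=
  n = m + (1, 0, 0) ∨ n = m + (0, 1, 0) ∨ n = m + (0, 0, 1)

instance (m n : Cell) : Decidable (Adjacent m n) := by
  unfold Adjacent; infer_instance

/-- A lozenge: an upward and a downward pointing unit triangle (that share an edge). -/
abbrev Lozenge : Type := Cell × Cell

/-- The lozenges contained in the punctured hexagon. -/
def lozenges (p : HexParams) : Finset Lozenge :=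
  (p.upCells ×ˢ p.downCells).filter fun l => Adjacent l.1 l.2

/-- A set of lozenges tiles the punctured hexagon if every unit triangle of the region lies in
exactly one of them. -/
def IsTiling (p : HexParams) (T : Finset Lozenge) : Prop :=
  (∀ m ∈ p.upCells, ∃! l, l ∈ T ∧ l.1 = m) ∧ (∀ n ∈ p.downCells, ∃! l, l ∈ T ∧ l.2 = n)

open Classical in
/-- The finite set of all lozenge tilings of the punctured hexagon. -/
noncomputable def lozengeTilings (p : HexParams) : Finset (Finset Lozenge) :=
  p.lozenges.powerset.filter p.IsTiling

/-- The points `A_1, …, A_C` (on the hexagon side of length `C`) and `A_{C+1}, …, A_{C+M}`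
(on the puncture), numbered from `0` here. -/
def startPt (p : HexParams) (i : Fin (p.C + p.M)) : ℤ × ℤ :=
  if (i : ℕ) < p.C then (((i : ℕ) : ℤ), (p.B : ℤ) + p.M + (i : ℕ))
  else ((p.β : ℤ) + (i : ℕ) - p.C, (p.B : ℤ) - p.α + (i : ℕ))

/-- The points `E_1, …, E_{C+M}` (on the hexagon side of length `C + M`),
numbered from `0` here. -/
def endPt (p : HexParams) (j : Fin (p.C + p.M)) : ℤ × ℤ :=
  ((p.A : ℤ) + (j : ℕ), ((j : ℕ) : ℤ))

/-- A unit step of a lattice path: to the right or down. -/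
def Step (P Q : ℤ × ℤ) : Prop := Q = P + (1, 0) ∨ Q = P + (0, -1)

/-- `w` is the list of lattice points visited by a lattice path from `P` to `Q`. -/
def IsLatticePath (P Q : ℤ × ℤ) (w : List (ℤ × ℤ)) : Prop :=
  w.head? = some P ∧ w.getLast? = some Q ∧ w.IsChain Step

/-- A family of non-intersecting lattice paths: a permutation `perm` and, for each `i`, a lattice
path from `A_i` to `E_{perm i}`, no two of which have a lattice point in common. -/
structure PathFamily (p : HexParams) where
  perm : Equiv.Perm (Fin (p.C + p.M))
  path : Fin (p.C + p.M) → List (ℤ × ℤ)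
  isLatticePath : ∀ i, IsLatticePath (p.startPt i) (p.endPt (perm i)) (path i)
  nonIntersecting : ∀ i j, i ≠ j → List.Disjoint (path i) (path j)

/-- The sign of a family of non-intersecting lattice paths. -/
def PathFamily.sgn {p : HexParams} (F : p.PathFamily) : ℤ :=
  ((Equiv.Perm.sign F.perm : ℤˣ) : ℤ)

/-- The unit steps that occur in the paths of a family. -/
def PathFamily.steps {p : HexParams} (F : p.PathFamily) : Set ((ℤ × ℤ) × (ℤ × ℤ)) :=
  {e | ∃ i, e ∈ (F.path i).zip (F.path i).tail}

/-- Every unit triangle has exactly one edge parallel to the hexagon side of length `C` (the side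
`w = c`). `mark p t` is the midpoint of that edge of `t` after orthogonalisation: motion parallel
to the side of length `A` (`u` constant) is horizontal, motion parallel to the side of length `B`
(`v` constant) is vertical. -/
def mark (p : HexParams) (t : Cell) : ℤ × ℤ := ((t.2.1 : ℤ), (p.a : ℤ) - 1 - t.1)

/-- The unit segments drawn by a tiling: on each lozenge that has two different marked midpoints,
these are connected (in the direction from the upward to the downward pointing triangle). A
lozenge whose two triangles share the marked edge has only one marked midpoint, and nothing is
drawn on it. -/
def segments (p : HexParams) (T : Finset Lozenge) : Set ((ℤ × ℤ) × (ℤ × ℤ)) :=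
  {e | ∃ l ∈ T, p.mark l.1 ≠ p.mark l.2 ∧ e = (p.mark l.1, p.mark l.2)}

/-- The family `F` is the one associated to the tiling `T`: the unit steps of its paths are
exactly the segments drawn by the lozenges of `T`. -/
def IsAssociated (p : HexParams) (T : Finset Lozenge) (F : p.PathFamily) : Prop :=
  F.steps = p.segments T

end HexParams

/-!
The signed enumeration of tilings is a Lindström-Gessel-Viennot formula. It is proved here without
exchanging tails of paths, by expanding one bordered determinant.

Let `V` be the set of marked points of the hexagon, those inside the puncture included, and let `t`
be the adjacency matrix of the unit steps on `V`. Border `1 - t` by the indicator columns of the end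
points and the indicator rows of the starting points. Since steps raise the difference of the
coordinates, `1 - t` is unitriangular, and block elimination shows that the bordered determinant is,
up to the sign `(-1) ^ (C + M)`, the minor of `(1 - t)⁻¹` at the starting and end points
(`det_borderedMatrix`). Pascal's recursion identifies this minor with the binomial matrix `N`
(`HexParams.det_N`): lattice paths cannot leave the hexagon on their way to an end point, and paths
through the puncture are counted at this stage.

The nonzero terms of the Leibniz expansion of the bordered determinant belong to permutations that
send each point to itself or along a step, each end point to its label, and each label to its
starting point (`IsRouting`). Such a permutation fixes all points inside the puncture, since a path
could leave the puncture only across an edge that consists of starting points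
(`HexParams.apply_of_inPuncture`). What is left is a bijection from the marks of the upward
triangles to the marks of the downward triangles that moves each point by at most one step, which is
a lozenge tiling (`HexParams.exists_routing`, `HexParams.exists_tiling`). The orbits of the
permutation are the paths associated to the tiling (`IsRouting.exists_paths`).

The sign of a Leibniz term is found by using the determinant identity a second time, for the graph
that has only the steps of one given routing. That routing is then the only nonzero term, and the
path counts form the matrix of the permutation of the family of paths (`IsRouting.sign_mul_prod`).
-/

/-! ### Lists that are chains for a relation -/

namespace List

variable {X : Type*} {R : X → X → Prop}

theorem IsChain.rel_of_mem_zip_tail {l : List X} (h : l.IsChain R) {e : X × X}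
    (he : e ∈ l.zip l.tail) : R e.1 e.2 := by
  induction l with
  | nil => simp at he
  | cons x l ih =>
    cases l with
    | nil => simp at he
    | cons y l =>
      rw [isChain_cons_cons] at h
      simp only [tail_cons, zip_cons_cons, mem_cons] at he
      rcases he with rfl | he
      · exact h.1
      · exact ih h.2 he

theorem isChain_of_forall_mem_zip_tail {l : List X}
    (h : ∀ e ∈ l.zip l.tail, R e.1 e.2) : l.IsChain R := by
  induction l with
  | nil => simp
  | cons x l ih =>
    cases l with
    | nil => simp
    | cons y l =>
      rw [isChain_cons_cons]
      simp only [tail_cons, zip_cons_cons, mem_cons, forall_eq_or_imp] at h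
      exact ⟨h.1, ih h.2⟩

theorem exists_mem_zip_tail_of_ne_head {l : List X} {P v : X} (hP : l.head? = some P)
    (hv : v ∈ l) (hne : v ≠ P) : ∃ u, (u, v) ∈ l.zip l.tail := by
  induction l generalizing P with
  | nil => simp at hv
  | cons x l ih =>
    obtain rfl : x = P := by simpa using hP
    have hv' : v ∈ l := by simpa [hne] using hv
    cases l with
    | nil => simp at hv'
    | cons y l =>
      by_cases hy : v = y
      · exact ⟨x, by simp [hy]⟩
      · obtain ⟨u, hu⟩ := ih (P := y) rfl hv' hy
        exact ⟨u, by simpa using Or.inr hu⟩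

theorem exists_mem_zip_tail_of_ne_getLast {l : List X} {Q v : X} (hQ : l.getLast? = some Q)
    (hv : v ∈ l) (hne : v ≠ Q) : ∃ w, (v, w) ∈ l.zip l.tail := by
  induction l with
  | nil => simp at hv
  | cons x l ih =>
    cases l with
    | nil => simp_all
    | cons y l =>
      rcases mem_cons.1 hv with rfl | hv'
      · exact ⟨y, by simp⟩
      · obtain ⟨w, hw⟩ := ih (by simpa using hQ) hv'
        exact ⟨w, by simpa using Or.inr hw⟩

/-- A chain for a functional relation that runs until it can go no further is determined by its
first element. -/
theorem IsChain.eq_of_functional (hR : ∀ u v w, R u v → R u w → v = w) {l l' : List X}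
    {P Q Q' : X} (hl : l.IsChain R) (hl' : l'.IsChain R) (hP : l.head? = some P)
    (hP' : l'.head? = some P) (hQ : l.getLast? = some Q) (hQ' : l'.getLast? = some Q')
    (hQR : ∀ w, ¬ R Q w) (hQR' : ∀ w, ¬ R Q' w) : l = l' := by
  induction l generalizing l' P with
  | nil => simp at hP
  | cons x l ih =>
    obtain rfl : x = P := by simpa using hP
    cases l' with
    | nil => simp at hP'
    | cons x' l' =>
      obtain rfl : x' = x := by simpa using hP'
      cases l with
      | nil =>
        obtain rfl : x' = Q := by simpa using hQ
        cases l' with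
        | nil => rfl
        | cons y' l' => exact absurd (isChain_cons_cons.1 hl').1 (hQR _)
      | cons y l =>
        rw [isChain_cons_cons] at hl
        cases l' with
        | nil =>
          obtain rfl : x' = Q' := by simpa using hQ'
          exact absurd hl.1 (hQR' _)
        | cons y' l' =>
          rw [isChain_cons_cons] at hl'
          obtain rfl := hR _ _ _ hl.1 hl'.1
          rw [ih hl.2 hl'.2 rfl rfl (by simpa using hQ) (by simpa using hQ')]

end List

/-! ### A determinant that counts routings -/

section Routing

open Equiv Matrix

variable {V : Type*} {n : ℕ} (s e : Fin n → V)

/-- The matrix `1 - t` of a weighted directed graph on `V`, bordered by a column for each end point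
`e j` and a row for each starting point `s i`. -/
def borderedMatrix [DecidableEq V] (t : Matrix V V ℤ) : Matrix (V ⊕ Fin n) (V ⊕ Fin n) ℤ :=
  fromBlocks (1 - t) (of fun v j => if v = e j then 1 else 0)
    (of fun i v => if v = s i then 1 else 0) 0

theorem det_one_sub_of_level_lt [Fintype V] [DecidableEq V] {t : Matrix V V ℤ} (h : V → ℤ)
    (ht : ∀ v w, t v w ≠ 0 → h v < h w) : (1 - t).det = 1 := by
  have hb : (1 - t).BlockTriangular h := by
    intro v w hvw
    have h1 : v ≠ w := by rintro rfl; exact lt_irrefl _ hvw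
    have h2 : t v w = 0 := by
      by_contra h2
      exact absurd (ht v w h2) (not_lt.2 hvw.le)
    simp [h1, h2]
  rw [hb.det]
  refine Finset.prod_eq_one fun k _ => ?_
  have : (1 - t).toSquareBlock h k = 1 := by
    ext ⟨v, hv⟩ ⟨w, hw⟩
    have h2 : t v w = 0 := by
      by_contra h2
      have := ht v w h2
      omega
    simp [toSquareBlock_def, h2, Matrix.one_apply]
  rw [this, det_one]

/-- The solution `P` of `(1 - t) P = (indicators of the end points)` has as entries the weighted
numbers of paths to the end points; the bordered determinant picks out its minor at the starting
points. -/
theorem det_borderedMatrix [Fintype V] [DecidableEq V] {t : Matrix V V ℤ} (h : V → ℤ)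
    (ht : ∀ v w, t v w ≠ 0 → h v < h w) {P : Matrix V (Fin n) ℤ}
    (hP : ∀ v j, P v j - ∑ w, t v w * P w j = if v = e j then 1 else 0) :
    (borderedMatrix s e t).det = (-1) ^ n * (of fun i j => P (s i) j).det := by
  have hmul : borderedMatrix s e t * fromBlocks 1 P 0 (-1) =
      fromBlocks (1 - t) 0 (of fun i v => if v = s i then 1 else 0) (of fun i j => P (s i) j) := by
    rw [borderedMatrix, fromBlocks_multiply]
    congr 1
    · simp
    · ext v j
      have h1 : ((1 - t) * P : Matrix V (Fin n) ℤ) v j = if v = e j then 1 else 0 := by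
        rw [Matrix.sub_mul, Matrix.one_mul, Matrix.sub_apply, Matrix.mul_apply, hP]
      simp only [Matrix.add_apply, h1, Matrix.mul_neg, Matrix.mul_one, Matrix.neg_apply, of_apply,
        add_neg_cancel, Matrix.zero_apply]
    · simp
    · ext i j
      simp [Matrix.mul_apply]
  have hdet := congrArg det hmul
  rw [det_mul, det_fromBlocks_zero₂₁, det_fromBlocks_zero₁₂, det_one_sub_of_level_lt h ht] at hdet
  have hsq : ((-1 : ℤ) ^ n) * (-1) ^ n = 1 := by rw [← mul_pow]; simp
  simp only [det_one, one_mul, det_neg, Fintype.card_fin, mul_one] at hdet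
  rw [← hdet, mul_comm, mul_assoc, hsq, mul_one]

/-- A routing from the points `s i` to the points `e j` along the relation `step`. It encodes a
family of vertex-disjoint paths as a permutation: a vertex on a path is sent to its successor, any
other vertex to itself, an end point `e j` to the label `j`, and the label `i` to `s i`. -/
structure IsRouting (step : V → V → Prop) (τ : Perm (V ⊕ Fin n)) : Prop where
  start : ∀ i, τ (.inr i) = .inl (s i)
  finish : ∀ j, τ (.inl (e j)) = .inr j
  moves : ∀ v w, τ (.inl v) = .inl w → v = w ∨ step v w

/-- The vertex `v` is moved to `w ≠ v` by `τ`. -/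
def Moves (τ : Perm (V ⊕ Fin n)) (v w : V) : Prop := τ (.inl v) = .inl w ∧ v ≠ w

open Classical in
/-- The adjacency matrix of a relation. -/
noncomputable def relMatrix (r : V → V → Prop) : Matrix V V ℤ :=
  of fun v w => if r v w then 1 else 0

variable {s e}

theorem isRouting_of_borderedMatrix_ne_zero [DecidableEq V] {step : V → V → Prop}
    {τ : Perm (V ⊕ Fin n)}
    (h : ∀ x, borderedMatrix s e (relMatrix step) x (τ x) ≠ 0) : IsRouting s e step τ := by
  have hs : ∀ i, τ (.inr i) = .inl (s i) := by
    intro i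
    have := h (.inr i)
    rcases hx : τ (.inr i) with v | j
    · rw [hx] at this
      simp only [borderedMatrix, fromBlocks_apply₂₁, of_apply, ne_eq, ite_eq_right_iff,
        one_ne_zero, imp_false, not_not] at this
      rw [this]
    · rw [hx] at this
      simp [borderedMatrix] at this
  refine ⟨hs, fun j => ?_, fun v w hvw => ?_⟩
  · obtain ⟨x, hx⟩ := τ.surjective (.inr j)
    have := h x
    rw [hx] at this
    rcases x with v | i
    · simp only [borderedMatrix, fromBlocks_apply₁₂, of_apply, ne_eq, ite_eq_right_iff,
        one_ne_zero, imp_false, not_not] at this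
      rw [← this, hx]
    · rw [hs] at hx
      cases hx
  · have := h (.inl v)
    rw [hvw] at this
    by_contra hne
    push Not at hne
    simp [borderedMatrix, relMatrix, hne.1, hne.2] at this

variable {step : V → V → Prop} {τ : Perm (V ⊕ Fin n)}

theorem IsRouting.moves_iff (hτ : IsRouting s e step τ) (hirr : ∀ v, ¬ step v v) {v w : V}
    (h : τ (.inl v) = .inl w) : step v w ↔ Moves τ v w := by
  constructor
  · rintro hs
    exact ⟨h, by rintro rfl; exact hirr _ hs⟩
  · rintro ⟨-, hne⟩
    exact (hτ.moves v w h).resolve_left hne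

/-- In the graph that consists only of the steps of a routing, that routing is the only one: where
another one stays instead of moving, it must also have stayed one step earlier. -/
theorem IsRouting.eq_of_isRouting_moves [Finite V] (hτ : IsRouting s e step τ) (h : V → ℤ)
    (hstep : ∀ v w, step v w → h v < h w) {ρ : Perm (V ⊕ Fin n)}
    (hρ : IsRouting s e (Moves τ) ρ) : ρ = τ := by
  by_contra hne
  have hbad : ∃ v, ρ (.inl v) ≠ τ (.inl v) := by
    by_contra! hall
    refine hne (Equiv.ext fun x => ?_)
    rcases x with v | i
    · exact hall v
    · rw [hρ.start, hτ.start]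
  obtain ⟨v, hv, hmin⟩ := Set.exists_min_image {v | ρ (.inl v) ≠ τ (.inl v)} h
    (Set.toFinite _) hbad
  have hv : ρ (.inl v) ≠ τ (.inl v) := hv
  rcases hρv : ρ (.inl v) with w | j
  · rcases hρ.moves v w hρv with rfl | hm
    · -- `ρ` fixes `v`; the `τ`-predecessor of `v` is a bad vertex of lower level
      obtain ⟨x, hx⟩ := τ.surjective (.inl v)
      rcases x with u | i
      · have huv : u ≠ v := by
          rintro rfl
          exact hv (by rw [hρv, hx])
        have hu : ρ (.inl u) ≠ τ (.inl u) := by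
          rw [hx, ← hρv]
          intro h'
          exact huv (Sum.inl_injective (ρ.injective h'))
        have := hmin u hu
        have := hstep u v ((hτ.moves u v hx).resolve_left huv)
        omega
      · have h1 := hρ.start i
        rw [← hτ.start i, hx, ← hρv] at h1
        cases ρ.injective h1
    · exact hv (by rw [hρv, hm.1])
  · have h1 := hρ.finish j
    rw [← hρv] at h1
    have h2 := Sum.inl_injective (ρ.injective h1)
    rw [← h2, hρ.finish, hτ.finish] at hv
    exact hv rfl

/-- If vertex-disjoint lists of vertices trace the paths of a routing `τ` and lead from `s i` to
`e (σ i)`, then the Leibniz term of `τ` in the bordered determinant is the sign of `σ`, up to the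
sign `(-1) ^ n`. The term is a bordered determinant itself, for the graph that consists only of the
steps of `τ`; and there the path counts form the permutation matrix of `σ`. -/
theorem IsRouting.sign_mul_prod [Fintype V] [DecidableEq V] (hτ : IsRouting s e step τ) (h : V → ℤ)
    (hstep : ∀ v w, step v w → h v < h w) (σ : Perm (Fin n)) (path : Fin n → List V)
    (hs : ∀ i, s i ∈ path i) (he : ∀ i, e (σ i) ∈ path i)
    (hdisj : ∀ i j v, v ∈ path i → v ∈ path j → i = j)
    (hmoves : ∀ v w, Moves τ v w → ∃ i, v ∈ path i ∧ w ∈ path i)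
    (hnext : ∀ i, ∀ v ∈ path i, v = e (σ i) ∨ ∃ w ∈ path i, Moves τ v w) :
    (Perm.sign τ : ℤ) * ∏ x, borderedMatrix s e (relMatrix step) x (τ x) =
      (-1) ^ n * (Perm.sign σ : ℤ) := by
  classical
  have hirr : ∀ v, ¬ step v v := fun v hv => lt_irrefl _ (hstep v v hv)
  have hMstep : ∀ v w, Moves τ v w → step v w := fun v w hm => (hτ.moves v w hm.1).resolve_left hm.2
  have hprod : ∏ x, borderedMatrix s e (relMatrix step) x (τ x) =
      ∏ x, borderedMatrix s e (relMatrix (Moves τ)) x (τ x) := by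
    refine Finset.prod_congr rfl fun x _ => ?_
    rcases x with v | i
    · rcases hv : τ (.inl v) with w | j
      · simp [borderedMatrix, relMatrix, hτ.moves_iff hirr hv]
      · simp [borderedMatrix]
    · simp [hτ.start, borderedMatrix]
  have hdet : (borderedMatrix s e (relMatrix (Moves τ))).det =
      (Perm.sign τ : ℤ) * ∏ x, borderedMatrix s e (relMatrix (Moves τ)) x (τ x) := by
    rw [← det_transpose, det_apply']
    refine Finset.sum_eq_single τ (fun ρ _ hρ => ?_) (by simp)
    by_contra hne
    refine hρ (hτ.eq_of_isRouting_moves h hstep (isRouting_of_borderedMatrix_ne_zero ?_))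
    intro x hx
    refine hne ?_
    simp only [transpose_apply]
    rw [Finset.prod_eq_zero (Finset.mem_univ x) hx, mul_zero]
  rw [hprod, ← hdet,
    det_borderedMatrix s e h (P := of fun v j => if v ∈ path (σ.symm j) then 1 else 0)]
  · congr 1
    have hdetσ := det_permutation (R := ℤ) σ
    rw [Int.cast_id] at hdetσ
    rw [← hdetσ]
    congr 1
    ext i j
    have : s i ∈ path (σ.symm j) ↔ σ i = j := by
      constructor
      · intro hi
        rw [hdisj _ _ _ (hs i) hi, Equiv.apply_symm_apply]
      · rintro rfl
        simpa using hs i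
    simp [this, PEquiv.toMatrix_apply, eq_comm]
  · intro v w hvw
    refine hstep v w (hMstep v w ?_)
    by_contra hm
    simp [relMatrix, hm] at hvw
  · intro v j
    obtain ⟨i, rfl⟩ := σ.surjective j
    simp only [relMatrix, of_apply, Equiv.symm_apply_apply]
    by_cases hv : ∃ w, Moves τ v w
    · obtain ⟨w, hw⟩ := hv
      have huniq : ∀ w', Moves τ v w' ↔ w' = w := by
        intro w'
        constructor
        · intro hw'
          exact Sum.inl_injective (hw'.1.symm.trans hw.1)
        · rintro rfl
          exact hw
      have hve : v ≠ e (σ i) := by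
        rintro rfl
        have := hτ.finish (σ i)
        rw [hw.1] at this
        cases this
      have hiff : v ∈ path i ↔ w ∈ path i := by
        constructor
        · intro hvi
          obtain ⟨w', hw', hm⟩ := (hnext i v hvi).resolve_left hve
          rwa [(huniq w').1 hm] at hw'
        · intro hwi
          obtain ⟨k, hvk, hwk⟩ := hmoves v w hw
          rwa [hdisj i k w hwi hwk]
      simp only [huniq, hve, hiff, ite_mul, one_mul, zero_mul, Finset.sum_ite_eq',
        Finset.mem_univ, if_true, if_false, sub_self]
    · push Not at hv
      have hiff : v ∈ path i ↔ v = e (σ i) := by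
        constructor
        · intro hvi
          refine (hnext i v hvi).resolve_right ?_
          rintro ⟨w, -, hw⟩
          exact hv w hw
        · rintro rfl
          exact he i
      simp [hv, hiff]

/-! ### The paths of a routing -/

/-- Iterating a routing from a vertex that is not fixed reaches an end point, since the level rises
and a moved vertex is not sent to a fixed one. -/
theorem IsRouting.exists_path [Finite V] (hτ : IsRouting s e step τ) (h : V → ℤ)
    (hstep : ∀ v w, step v w → h v < h w) (v : V) (hv : τ (.inl v) ≠ .inl v) :
    ∃ (j : Fin n) (l : List V), l.head? = some v ∧ l.getLast? = some (e j) ∧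
      l.IsChain (Moves τ) := by
  have hwf : WellFounded fun v w : V => h w < h v := by
    have : IsTrans V fun v w : V => h w < h v := ⟨fun _ _ _ h1 h2 => lt_trans h2 h1⟩
    have : Std.Irrefl fun v w : V => h w < h v := ⟨fun _ => lt_irrefl _⟩
    exact Finite.wellFounded_of_trans_of_irrefl _
  induction v using hwf.induction with
  | _ v ih =>
  rcases hx : τ (.inl v) with w | j
  · have hvw : v ≠ w := by
      rintro rfl
      exact hv hx
    obtain ⟨j, l, hl, hl', hl''⟩ := ih w (hstep v w ((hτ.moves v w hx).resolve_left hvw)) (by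
      intro h'
      exact hvw (Sum.inl_injective (τ.injective (h'.trans hx.symm))).symm)
    cases l with
    | nil => simp at hl
    | cons y l =>
      obtain rfl : y = w := by simpa using hl
      exact ⟨j, v :: y :: l, rfl, by simpa using hl', List.isChain_cons_cons.2 ⟨⟨hx, hvw⟩, hl''⟩⟩
  · refine ⟨j, [v], rfl, ?_, by simp⟩
    have := hτ.finish j
    rw [← hx] at this
    simp [Sum.inl_injective (τ.injective this)]

/-- The moves of a routing decompose into disjoint paths from the starting points to the end points:
going backwards from any moved vertex, one arrives at exactly one starting point. -/
theorem IsRouting.exists_paths [Finite V] (hτ : IsRouting s e step τ) (h : V → ℤ)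
    (hstep : ∀ v w, step v w → h v < h w) :
    ∃ (σ : Perm (Fin n)) (path : Fin n → List V),
      (∀ i, (path i).head? = some (s i)) ∧ (∀ i, (path i).getLast? = some (e (σ i))) ∧
      (∀ i, (path i).IsChain (Moves τ)) ∧
      (∀ i j v, v ∈ path i → v ∈ path j → i = j) ∧
      (∀ v w, Moves τ v w → ∃ i, (v, w) ∈ (path i).zip (path i).tail) := by
  have hMstep : ∀ v w, Moves τ v w → h v < h w :=
    fun v w hm => hstep v w ((hτ.moves v w hm.1).resolve_left hm.2)
  have hwf : WellFounded fun v w : V => h v < h w := by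
    have : IsTrans V fun v w : V => h v < h w := ⟨fun _ _ _ h1 h2 => lt_trans h1 h2⟩
    have : Std.Irrefl fun v w : V => h v < h w := ⟨fun _ => lt_irrefl _⟩
    exact Finite.wellFounded_of_trans_of_irrefl _
  have hs_inj : Function.Injective s := by
    intro i j hij
    have h1 := hτ.start i
    rw [hij, ← hτ.start j] at h1
    exact Sum.inr_injective (τ.injective h1)
  have hnopred : ∀ u i, ¬ Moves τ u (s i) := by
    intro u i hm
    have h1 := hm.1
    rw [← hτ.start i] at h1
    cases τ.injective h1
  have hnosucc : ∀ w j, ¬ Moves τ (e j) w := by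
    intro w j hm
    have h1 := hm.1
    rw [hτ.finish j] at h1
    cases h1
  choose f path hhead hlast hchain using fun i => hτ.exists_path h hstep (s i) (by
    intro h'
    cases τ.injective (h'.trans (hτ.start i).symm))
  have hdisj : ∀ v, ∀ i j, v ∈ path i → v ∈ path j → i = j := by
    intro v
    induction v using hwf.induction with
    | _ v ih =>
    intro i j hi hj
    by_cases hvi : v = s i
    · by_cases hvj : v = s j
      · exact hs_inj (hvi.symm.trans hvj)
      · obtain ⟨u, hu⟩ := List.exists_mem_zip_tail_of_ne_head (hhead j) hj hvj
        have := (hchain j).rel_of_mem_zip_tail hu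
        rw [hvi] at this
        exact absurd this (hnopred _ _)
    · obtain ⟨u, hu⟩ := List.exists_mem_zip_tail_of_ne_head (hhead i) hi hvi
      have hm := (hchain i).rel_of_mem_zip_tail hu
      by_cases hvj : v = s j
      · rw [hvj] at hm
        exact absurd hm (hnopred _ _)
      · obtain ⟨u', hu'⟩ := List.exists_mem_zip_tail_of_ne_head (hhead j) hj hvj
        have hm' := (hchain j).rel_of_mem_zip_tail hu'
        obtain rfl : u = u' := Sum.inl_injective (τ.injective (hm.1.trans hm'.1.symm))
        exact ih u (hMstep _ _ hm) i j (List.of_mem_zip hu).1 (List.of_mem_zip hu').1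
  have hf : Function.Injective f := by
    intro i j hij
    refine hdisj (e (f i)) i j (List.mem_of_getLast? (hlast i)) ?_
    rw [hij]
    exact List.mem_of_getLast? (hlast j)
  have hsucc : ∀ i, ∀ v ∈ path i, ∀ w, Moves τ v w → (v, w) ∈ (path i).zip (path i).tail := by
    intro i v hv w hm
    obtain ⟨w', hw'⟩ := List.exists_mem_zip_tail_of_ne_getLast (hlast i) hv (by
      rintro rfl
      exact hnosucc _ _ hm)
    have hm' := (hchain i).rel_of_mem_zip_tail hw'
    obtain rfl : w = w' := Sum.inl_injective (hm.1.symm.trans hm'.1)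
    exact hw'
  have hcover : ∀ v, ∀ w, Moves τ v w → ∃ i, v ∈ path i := by
    intro v
    induction v using hwf.induction with
    | _ v ih =>
    intro w hm
    obtain ⟨x, hx⟩ := τ.surjective (.inl v)
    rcases x with u | i
    · have huv : u ≠ v := by
        rintro rfl
        exact hm.2 (Sum.inl_injective (hx.symm.trans hm.1))
      obtain ⟨i, hi⟩ := ih u (hMstep u v ⟨hx, huv⟩) v ⟨hx, huv⟩
      exact ⟨i, List.mem_of_mem_tail (List.of_mem_zip (hsucc i u hi v ⟨hx, huv⟩)).2⟩
    · refine ⟨i, ?_⟩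
      rw [hτ.start] at hx
      rw [← Sum.inl_injective hx]
      exact List.mem_of_head? (hhead i)
  refine ⟨Equiv.ofBijective f (Finite.injective_iff_bijective.1 hf), path, hhead, hlast, hchain,
    fun i j v => hdisj v i j, fun v w hm => ?_⟩
  obtain ⟨i, hi⟩ := hcover v w hm
  exact ⟨i, hsucc i v hi w hm⟩

end Routing

namespace HexParams

open Equiv Matrix

variable {p : HexParams}

/-! ### The lattice points of the hexagon -/

/-- The marked points of the hexagon, including those inside the puncture. The difference of the
coordinates is constant along the side `w = c` and grows by one with each step of a lattice path;
it is `-(B + M)` on that side and `A` on the opposite side. -/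
noncomputable def hexPoints (p : HexParams) : Finset (ℤ × ℤ) :=
  (Finset.Ico (0 : ℤ) p.b ×ˢ Finset.Ico (0 : ℤ) p.a).filter fun v =>
    -((p.B : ℤ) + p.M) ≤ v.1 - v.2 ∧ v.1 - v.2 ≤ p.A

/-- The marked points of the puncture that are not on its edge parallel to `w = c`. Neither of the
two unit triangles at such a point belongs to the punctured hexagon. -/
def InPuncture (p : HexParams) (v : ℤ × ℤ) : Prop :=
  (p.β : ℤ) ≤ v.1 ∧ v.2 + 1 + p.α ≤ p.a ∧ v.1 - v.2 < (p.A : ℤ) - p.γ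

theorem mem_hexPoints {v : ℤ × ℤ} : v ∈ p.hexPoints ↔
    (0 ≤ v.1 ∧ v.1 < p.b) ∧ (0 ≤ v.2 ∧ v.2 < p.a) ∧
      -((p.B : ℤ) + p.M) ≤ v.1 - v.2 ∧ v.1 - v.2 ≤ p.A := by
  simp [hexPoints, and_assoc]

theorem mem_upCells {m : Cell} : m ∈ p.upCells ↔
    m.1 < p.a ∧ m.2.1 < p.b ∧ m.2.2 < p.c ∧ ¬ (p.α ≤ m.1 ∧ p.β ≤ m.2.1 ∧ p.γ ≤ m.2.2) ∧
      m.1 + m.2.1 + m.2.2 + 2 = p.S := by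
  simp only [upCells, cells, Finset.mem_filter, Finset.mem_product, Finset.mem_range, and_assoc]

theorem mem_downCells {m : Cell} : m ∈ p.downCells ↔
    m.1 < p.a ∧ m.2.1 < p.b ∧ m.2.2 < p.c ∧ ¬ (p.α ≤ m.1 ∧ p.β ≤ m.2.1 ∧ p.γ ≤ m.2.2) ∧
      m.1 + m.2.1 + m.2.2 + 1 = p.S := by
  simp only [downCells, cells, Finset.mem_filter, Finset.mem_product, Finset.mem_range, and_assoc]

/-- The definitions of `S`, `A`, `B`, `C` and `M` without division and subtraction. -/
theorem Admissible.add_eq (hp : p.Admissible) :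
    p.A + p.a = p.S ∧ p.B + p.b = p.S ∧ p.C + p.c = p.S ∧ p.M + (p.α + p.β + p.γ) = p.S ∧
      3 * p.S = p.a + p.b + p.c + p.α + p.β + p.γ := by
  have h1 := hp.A_nonneg
  have h2 := hp.B_nonneg
  have h3 := hp.C_nonneg
  have h4 := hp.M_nonneg
  have h5 := hp.three_dvd
  refine ⟨?_, ?_, ?_, ?_, ?_⟩
  · unfold A; omega
  · unfold B; omega
  · unfold C; omega
  · unfold M; omega
  · unfold S; omega

theorem mark_up (hp : p.Admissible) {m : Cell} (hm : m ∈ p.upCells) :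
    p.mark m ∈ p.hexPoints ∧ (p.mark m).1 - (p.mark m).2 < p.A ∧ ¬ p.InPuncture (p.mark m) := by
  obtain ⟨h1, h2, h3, h4, h5⟩ := hp.add_eq
  rw [mem_upCells] at hm
  rw [mem_hexPoints]
  unfold InPuncture mark
  omega

theorem mark_down (hp : p.Admissible) {m : Cell} (hm : m ∈ p.downCells) :
    p.mark m ∈ p.hexPoints ∧ ¬ p.InPuncture (p.mark m) ∧ ∀ i, p.mark m ≠ p.startPt i := by
  obtain ⟨h1, h2, h3, h4, h5⟩ := hp.add_eq
  rw [mem_downCells] at hm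
  rw [mem_hexPoints]
  refine ⟨?_, ?_, fun i hi => ?_⟩
  · unfold mark
    omega
  · unfold InPuncture mark
    omega
  · have := i.2
    have := hp.C_le
    unfold startPt mark at hi
    split_ifs at hi <;> rw [Prod.ext_iff] at hi <;> dsimp only at hi <;> omega

theorem mark_up_inj {m m' : Cell} (hm : m ∈ p.upCells) (hm' : m' ∈ p.upCells)
    (h : p.mark m = p.mark m') : m = m' := by
  rw [mem_upCells] at hm hm'
  unfold mark at h
  simp only [Prod.ext_iff] at h ⊢
  omega

theorem mark_down_inj {m m' : Cell} (hm : m ∈ p.downCells) (hm' : m' ∈ p.downCells)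
    (h : p.mark m = p.mark m') : m = m' := by
  rw [mem_downCells] at hm hm'
  unfold mark at h
  simp only [Prod.ext_iff] at h ⊢
  omega

theorem exists_up (hp : p.Admissible) {v : ℤ × ℤ} (hv : v ∈ p.hexPoints)
    (hA : v.1 - v.2 < p.A) (hv' : ¬ p.InPuncture v) : ∃ m ∈ p.upCells, p.mark m = v := by
  obtain ⟨h1, h2, h3, h4, h5⟩ := hp.add_eq
  obtain ⟨x, y⟩ := v
  rw [mem_hexPoints] at hv
  unfold InPuncture at hv'
  dsimp only at hv hA hv'
  refine ⟨((p.a - 1 - y).toNat, x.toNat, (p.A - 1 - (x - y)).toNat), ?_, ?_⟩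
  · rw [mem_upCells]
    dsimp only
    omega
  · unfold mark
    rw [Prod.ext_iff]
    dsimp only
    omega

theorem exists_startPt (hp : p.Admissible) {v : ℤ × ℤ} (h1 : (p.β : ℤ) ≤ v.1)
    (h2 : v.2 + 1 + p.α ≤ p.a) (h3 : v.1 - v.2 = (p.A : ℤ) - p.γ) : ∃ i, v = p.startPt i := by
  obtain ⟨e1, e2, e3, e4, e5⟩ := hp.add_eq
  refine ⟨⟨(v.1 - p.β + p.C).toNat, by omega⟩, ?_⟩
  unfold startPt
  rw [if_neg (by dsimp only; omega), Prod.ext_iff]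
  dsimp only
  omega

theorem exists_down (hp : p.Admissible) {v : ℤ × ℤ} (hv : v ∈ p.hexPoints)
    (hv' : ¬ p.InPuncture v) (hs : ∀ i, v ≠ p.startPt i) : ∃ m ∈ p.downCells, p.mark m = v := by
  have hpunct : ¬ ((p.β : ℤ) ≤ v.1 ∧ v.2 + 1 + p.α ≤ p.a ∧ v.1 - v.2 = (p.A : ℤ) - p.γ) := by
    rintro ⟨h1, h2, h3⟩
    obtain ⟨i, hi⟩ := exists_startPt hp h1 h2 h3
    exact hs i hi
  obtain ⟨h1, h2, h3, h4, h5⟩ := hp.add_eq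
  obtain ⟨x, y⟩ := v
  rw [mem_hexPoints] at hv
  unfold InPuncture at hv'
  dsimp only at hv hv' hpunct
  have hside : x - y ≠ -((p.B : ℤ) + p.M) := by
    intro h
    refine hs ⟨x.toNat, by omega⟩ ?_
    unfold startPt
    rw [if_pos (by dsimp only; omega), Prod.ext_iff]
    dsimp only
    omega
  refine ⟨((p.a - 1 - y).toNat, x.toNat, (p.A - (x - y)).toNat), ?_, ?_⟩
  · rw [mem_downCells]
    dsimp only
    omega
  · unfold mark
    rw [Prod.ext_iff]
    dsimp only
    omega

theorem adjacent_iff {m n : Cell} (hm : m ∈ p.upCells) (hn : n ∈ p.downCells) :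
    Adjacent m n ↔ p.mark m = p.mark n ∨ Step (p.mark m) (p.mark n) := by
  rw [mem_upCells] at hm
  rw [mem_downCells] at hn
  obtain ⟨i, j, k⟩ := m
  obtain ⟨i', j', k'⟩ := n
  unfold Adjacent Step mark
  simp only [Prod.mk_add_mk, Prod.mk.injEq]
  dsimp only at hm hn
  omega

theorem Step.level {v w : ℤ × ℤ} (h : Step v w) : w.1 - w.2 = v.1 - v.2 + 1 := by
  rcases h with rfl | rfl
  · rw [Prod.fst_add, Prod.snd_add]; dsimp only; omega
  · rw [Prod.fst_add, Prod.snd_add]; dsimp only; omega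

theorem startPt_mem (hp : p.Admissible) (i : Fin (p.C + p.M)) :
    p.startPt i ∈ p.hexPoints ∧ ¬ p.InPuncture (p.startPt i) := by
  obtain ⟨h1, h2, h3, h4, h5⟩ := hp.add_eq
  have := hp.A_le
  have := hp.B_le
  have := hp.C_le
  have := hp.γ_lt
  have := i.2
  rw [mem_hexPoints]
  unfold InPuncture startPt
  split_ifs <;> dsimp only <;> omega

theorem endPt_mem (hp : p.Admissible) (j : Fin (p.C + p.M)) : p.endPt j ∈ p.hexPoints := by
  obtain ⟨h1, h2, h3, h4, h5⟩ := hp.add_eq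
  have := j.2
  rw [mem_hexPoints]
  unfold endPt
  dsimp only
  omega

theorem endPt_level (j : Fin (p.C + p.M)) : (p.endPt j).1 - (p.endPt j).2 = p.A := by
  unfold endPt
  dsimp only
  omega

theorem exists_endPt (hp : p.Admissible) {v : ℤ × ℤ} (hv : v ∈ p.hexPoints)
    (h : v.1 - v.2 = p.A) : ∃ j, v = p.endPt j := by
  obtain ⟨h1, h2, h3, h4, h5⟩ := hp.add_eq
  rw [mem_hexPoints] at hv
  refine ⟨⟨v.2.toNat, by omega⟩, ?_⟩
  unfold endPt
  rw [Prod.ext_iff]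
  dsimp only
  omega

theorem endPt_injective : Function.Injective p.endPt := by
  intro i j h
  unfold endPt at h
  rw [Prod.ext_iff] at h
  dsimp only at h
  exact Fin.ext (by omega)

theorem startPt_injective (hp : p.Admissible) : Function.Injective p.startPt := by
  obtain ⟨h1, h2, h3, h4, h5⟩ := hp.add_eq
  have := hp.γ_lt
  intro i j h
  unfold startPt at h
  refine Fin.ext ?_
  split_ifs at h <;> rw [Prod.ext_iff] at h <;> dsimp only at h <;> omega

/-- The starting points as points of the hexagon. -/
def startVertex (hp : p.Admissible) (i : Fin (p.C + p.M)) : p.hexPoints :=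
  ⟨p.startPt i, (startPt_mem hp i).1⟩

/-- The end points as points of the hexagon. -/
def endVertex (hp : p.Admissible) (j : Fin (p.C + p.M)) : p.hexPoints :=
  ⟨p.endPt j, endPt_mem hp j⟩

/-- The relation `Step` on the points of the hexagon. -/
def VertexStep (p : HexParams) (v w : p.hexPoints) : Prop := Step v.1 w.1

/-- The level of a point; it grows by one with each step. -/
def level (v : p.hexPoints) : ℤ := v.1.1 - v.1.2

theorem VertexStep.level_lt {v w : p.hexPoints} (h : p.VertexStep v w) : level v < level w := by
  have := Step.level h
  unfold level
  omega

/-! ### The binomial matrix as a bordered determinant -/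

theorem binom_of_neg (n : ℕ) {k : ℤ} (hk : k < 0) : binom n k = 0 := if_neg (by omega)

theorem binom_of_lt {n : ℕ} {k : ℤ} (hk : (n : ℤ) < k) : binom n k = 0 := by
  rw [binom, if_pos (by omega), Nat.choose_eq_zero_of_lt (by omega), Nat.cast_zero]

theorem binom_zero (k : ℤ) : binom 0 k = if k = 0 then 1 else 0 := by
  rcases lt_trichotomy k 0 with h | rfl | h
  · rw [binom_of_neg _ h, if_neg h.ne]
  · simp [binom]
  · rw [binom_of_lt (by simpa using h), if_neg h.ne']

theorem binom_succ (n : ℕ) (k : ℤ) : binom (n + 1) k = binom n (k - 1) + binom n k := by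
  rcases lt_trichotomy k 0 with h | rfl | h
  · rw [binom_of_neg _ h, binom_of_neg _ h, binom_of_neg _ (by omega), add_zero]
  · simp [binom]
  · obtain ⟨m, rfl⟩ : ∃ m : ℕ, k = m + 1 := ⟨(k - 1).toNat, by omega⟩
    rw [binom, binom, binom, if_pos (by omega), if_pos (by omega), if_pos (by omega)]
    have h1 : ((m : ℤ) + 1).toNat = m + 1 := by omega
    have h2 : ((m : ℤ) + 1 - 1).toNat = m := by omega
    rw [h1, h2, Nat.choose_succ_succ, Nat.cast_add]

/-- The number of all lattice paths from `v` to `E_j`: there are `A - (v.1 - v.2)` steps, of which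
`A + j - v.1` are horizontal. Beyond the level `A` of the end points `toNat` would report paths of
length `0`, hence the case distinction. -/
def pathCount (p : HexParams) (v : ℤ × ℤ) (j : Fin (p.C + p.M)) : ℤ :=
  if v.1 - v.2 ≤ p.A then binom ((p.A : ℤ) - (v.1 - v.2)).toNat ((p.A : ℤ) + (j : ℕ) - v.1) else 0

theorem pathCount_startPt (hp : p.Admissible) (i j : Fin (p.C + p.M)) :
    p.pathCount (p.startPt i) j = p.N i j := by
  obtain ⟨h1, h2, h3, h4, h5⟩ := hp.add_eq
  unfold pathCount N startPt
  rw [Matrix.of_apply]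
  split_ifs with hi h h
  · congr 1
    dsimp only
    omega
  · dsimp only at h
    omega
  · congr 1
    · dsimp only
      omega
    · dsimp only
      omega
  · dsimp only at h
    omega

/-- Steps from the hexagon across its boundary lead to points from which no end point can be
reached. -/
theorem pathCount_eq_zero_of_step (hp : p.Admissible) {v w : ℤ × ℤ} (hv : v ∈ p.hexPoints)
    (h : Step v w) (hw : w ∉ p.hexPoints) (j : Fin (p.C + p.M)) : p.pathCount w j = 0 := by
  obtain ⟨h1, h2, h3, h4, h5⟩ := hp.add_eq
  have := j.2
  obtain ⟨x, y⟩ := v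
  rw [mem_hexPoints] at hv hw
  unfold pathCount
  split_ifs with hA
  · rcases h with rfl | rfl <;> simp only [Prod.mk_add_mk] at hv hw hA ⊢
    · exact binom_of_neg _ (by omega)
    · exact binom_of_lt (by omega)
  · rfl

theorem pathCount_recursion {v : ℤ × ℤ} (hv : v.1 - v.2 ≤ p.A) (j : Fin (p.C + p.M)) :
    p.pathCount v j - (p.pathCount (v + (1, 0)) j + p.pathCount (v + (0, -1)) j) =
      if v = p.endPt j then 1 else 0 := by
  obtain ⟨x, y⟩ := v
  unfold pathCount endPt
  simp only [Prod.mk_add_mk, Prod.mk.injEq, add_zero] at hv ⊢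
  rw [if_pos hv]
  rcases hv.lt_or_eq with h | h
  · obtain ⟨m, hm⟩ : ∃ m : ℕ, (p.A : ℤ) - (x - y) = m + 1 := ⟨(p.A - (x - y) - 1).toNat, by omega⟩
    rw [if_pos (by omega), if_pos (by omega), if_neg (by omega),
      show ((p.A : ℤ) - (x - y)).toNat = m + 1 by omega,
      show ((p.A : ℤ) - (x + 1 - y)).toNat = m by omega,
      show ((p.A : ℤ) - (x - (y + -1))).toNat = m by omega, binom_succ,
      show (p.A : ℤ) + (j : ℕ) - (x + 1) = p.A + (j : ℕ) - x - 1 by omega, sub_self]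
  · rw [if_neg (by omega), if_neg (by omega), show ((p.A : ℤ) - (x - y)).toNat = 0 by omega,
      binom_zero, add_zero, sub_zero]
    exact if_congr (by omega) rfl rfl

/-- The path counts satisfy Pascal's recursion on the hexagon, so the binomial matrix is the minor
of path counts in `det_borderedMatrix`. -/
theorem det_N (hp : p.Admissible) :
    p.N.det = (-1) ^ (p.C + p.M) *
      (borderedMatrix (startVertex hp) (endVertex hp) (relMatrix p.VertexStep)).det := by
  classical
  rw [det_borderedMatrix _ _ level (P := of fun v j => p.pathCount v.1 j), ← mul_assoc, ← mul_pow]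
  · simp only [mul_neg, mul_one, neg_neg, one_pow, one_mul]
    congr 1
    ext i j
    exact (pathCount_startPt hp i j).symm
  · intro v w hvw
    refine VertexStep.level_lt ?_
    by_contra h
    simp [relMatrix, h] at hvw
  · rintro ⟨v, hv⟩ j
    have hsum : ∑ w : p.hexPoints, relMatrix p.VertexStep ⟨v, hv⟩ w * p.pathCount w.1 j =
        p.pathCount (v + (1, 0)) j + p.pathCount (v + (0, -1)) j := by
      have hne : v + (1, 0) ≠ v + (0, -1) := by
        intro h
        simpa using add_left_cancel h
      have hterm : ∀ w : p.hexPoints, relMatrix p.VertexStep ⟨v, hv⟩ w * p.pathCount w.1 j =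
          if Step v w.1 then p.pathCount w.1 j else 0 := by
        intro w
        by_cases h : Step v w.1 <;> simp [relMatrix, VertexStep, h]
      rw [Finset.sum_congr rfl fun w _ => hterm w,
        Finset.sum_coe_sort p.hexPoints (fun w => if Step v w then p.pathCount w j else 0),
        ← Finset.sum_filter, ← Finset.sum_pair (f := fun w => p.pathCount w j) hne]
      refine Finset.sum_subset ?_ ?_
      · intro w hw
        simpa [Step] using (Finset.mem_filter.1 hw).2
      · intro w hw hw'
        have hstep : Step v w := by simpa [Step] using hw
        refine pathCount_eq_zero_of_step hp hv hstep ?_ j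
        intro hmem
        exact hw' (Finset.mem_filter.2 ⟨hmem, hstep⟩)
    simp only [of_apply]
    rw [hsum, pathCount_recursion (mem_hexPoints.1 hv).2.2.2]
    simp only [endVertex, Subtype.mk.injEq]

/-! ### Tilings and routings -/

/-- The image of a vertex or label in the routing of a tiling `T`, as a relation. -/
inductive TileStep (hp : p.Admissible) (T : Finset Lozenge) :
    p.hexPoints ⊕ Fin (p.C + p.M) → p.hexPoints ⊕ Fin (p.C + p.M) → Prop
  | start (i) : TileStep hp T (.inr i) (.inl (startVertex hp i))
  | finish (j) : TileStep hp T (.inl (endVertex hp j)) (.inr j)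
  | puncture (v : p.hexPoints) (hv : p.InPuncture v.1) : TileStep hp T (.inl v) (.inl v)
  | lozenge (l : Lozenge) (hl : l ∈ T) (v w : p.hexPoints) (hv : p.mark l.1 = v.1)
      (hw : p.mark l.2 = w.1) : TileStep hp T (.inl v) (.inl w)

/-- The routing `τ` follows the lozenges of `T`. -/
def Follows (T : Finset Lozenge) (τ : Perm (p.hexPoints ⊕ Fin (p.C + p.M))) : Prop :=
  ∀ l ∈ T, ∀ v w : p.hexPoints, p.mark l.1 = v.1 → p.mark l.2 = w.1 → τ (.inl v) = .inl w

theorem mem_lozengeTilings {T : Finset Lozenge} :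
    T ∈ p.lozengeTilings ↔ T ⊆ p.lozenges ∧ p.IsTiling T := by
  classical
  simp [lozengeTilings]

theorem mem_lozenges {l : Lozenge} : l ∈ p.lozenges ↔
    l.1 ∈ p.upCells ∧ l.2 ∈ p.downCells ∧ Adjacent l.1 l.2 := by
  simp only [lozenges, Finset.mem_filter, Finset.mem_product, and_assoc]

theorem not_inPuncture_endPt (j : Fin (p.C + p.M)) : ¬ p.InPuncture (p.endPt j) := by
  have := endPt_level j
  unfold InPuncture
  omega

/-- The marks of the upward triangles, the end points and the points inside the puncture partition
the points of the hexagon, and so do the marks of the downward triangles, the starting points and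
the points inside the puncture; the lozenges of a tiling give a bijection between the first parts.
-/
theorem exists_routing (hp : p.Admissible) {T : Finset Lozenge} (hT : T ∈ p.lozengeTilings) :
    ∃ τ, IsRouting (startVertex hp) (endVertex hp) p.VertexStep τ ∧ Follows T τ := by
  obtain ⟨hsub, hup, hdown⟩ := mem_lozengeTilings.1 hT
  have hloz : ∀ l ∈ T, l.1 ∈ p.upCells ∧ l.2 ∈ p.downCells ∧ Adjacent l.1 l.2 :=
    fun l hl => mem_lozenges.1 (hsub hl)
  have htotal : ∀ x, ∃ y, TileStep hp T x y := by
    rintro (v | i)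
    · by_cases hP : p.InPuncture v.1
      · exact ⟨_, .puncture v hP⟩
      rcases (mem_hexPoints.1 v.2).2.2.2.lt_or_eq with hA | hA
      · obtain ⟨m, hm, hmv⟩ := exists_up hp v.2 hA hP
        obtain ⟨l, ⟨hl, rfl⟩, -⟩ := hup m hm
        exact ⟨_, .lozenge l hl v ⟨_, (mark_down hp (hloz l hl).2.1).1⟩ hmv rfl⟩
      · obtain ⟨j, hj⟩ := exists_endPt hp v.2 hA
        obtain rfl : v = endVertex hp j := Subtype.ext hj
        exact ⟨_, .finish j⟩
    · exact ⟨_, .start i⟩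
  have hinj : ∀ x x' y, TileStep hp T x y → TileStep hp T x' y → x = x' := by
    have hstart : ∀ i v, startVertex hp i = v → v.1 = p.startPt i := by
      rintro i _ rfl
      rfl
    have hnotstart : ∀ l ∈ T, ∀ w : p.hexPoints, p.mark l.2 = w.1 → ∀ i, startVertex hp i ≠ w := by
      intro l hl w hw i hi
      exact (mark_down hp (hloz l hl).2.1).2.2 i (hw.trans (hstart i w hi))
    have hnotpunct : ∀ l ∈ T, ∀ w : p.hexPoints, p.mark l.2 = w.1 → ¬ p.InPuncture w.1 := by
      intro l hl w hw
      rw [← hw]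
      exact (mark_down hp (hloz l hl).2.1).2.1
    have hstartpunct : ∀ i w, startVertex hp i = w → ¬ p.InPuncture w.1 := by
      rintro i _ rfl
      exact (startPt_mem hp i).2
    intro x x' y h h'
    generalize hy : y = y' at h'
    cases h with
    | start i =>
      cases h' with
      | start i' => rw [startPt_injective hp (Subtype.ext_iff.1 (Sum.inl_injective hy))]
      | finish j => cases hy
      | puncture v hv => exact absurd hv (hstartpunct _ _ (Sum.inl_injective hy))
      | lozenge l hl v w hv hw => exact absurd (Sum.inl_injective hy) (hnotstart l hl w hw i)
    | finish j =>
      cases h' with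
      | finish j' => rw [Sum.inr_injective hy]
      | start i => cases hy
      | puncture v hv => cases hy
      | lozenge l hl v w hv hw => cases hy
    | puncture v hv =>
      cases h' with
      | start i => exact absurd hv (hstartpunct _ _ (Sum.inl_injective hy).symm)
      | finish j => cases hy
      | puncture v' hv' => exact hy
      | lozenge l hl v' w hv' hw =>
        rw [Sum.inl_injective hy] at hv
        exact absurd hv (hnotpunct l hl w hw)
    | lozenge l hl v w hv hw =>
      cases h' with
      | start i => exact absurd (Sum.inl_injective hy).symm (hnotstart l hl w hw i)
      | finish j => cases hy
      | puncture v' hv' =>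
        rw [← Sum.inl_injective hy] at hv'
        exact absurd hv' (hnotpunct l hl w hw)
      | lozenge l' hl' v' w' hv' hw' =>
        obtain rfl := Sum.inl_injective hy
        have h2 : l.2 = l'.2 :=
          mark_down_inj (hloz l hl).2.1 (hloz l' hl').2.1 (hw.trans hw'.symm)
        obtain rfl : l = l' := (hdown l.2 (hloz l hl).2.1).unique ⟨hl, rfl⟩ ⟨hl', h2.symm⟩
        rw [Subtype.ext (hv.symm.trans hv')]
  choose f hf using htotal
  have hfinj : Function.Injective f := by
    intro x x' h
    have h1 := hf x
    rw [h] at h1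
    exact hinj _ _ _ h1 (hf x')
  have hnotup : ∀ l ∈ T, ∀ v : p.hexPoints, p.mark l.1 = v.1 →
      level v < p.A ∧ ¬ p.InPuncture v.1 := by
    intro l hl v hv
    have := mark_up hp (hloz l hl).1
    rw [hv] at this
    exact this.2
  have hend : ∀ j, level (endVertex hp j) = p.A := fun j => endPt_level j
  have hlevel : ∀ j v, endVertex hp j = v → ¬ p.InPuncture v.1 := by
    rintro j _ rfl
    exact not_inPuncture_endPt j
  refine ⟨Equiv.ofBijective f (Finite.injective_iff_bijective.1 hfinj), ⟨fun i => ?_, fun j => ?_,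
    fun v w hvw => ?_⟩, fun l hl v w hv hw => ?_⟩
  · have h := hf (.inr i)
    rw [Equiv.ofBijective_apply]
    generalize f (.inr i) = y at h
    cases h
    rfl
  · have h := hf (.inl (endVertex hp j))
    rw [Equiv.ofBijective_apply]
    generalize f (.inl (endVertex hp j)) = y at h
    generalize hx : endVertex hp j = x at h
    cases h with
    | finish j' => rw [endPt_injective (Subtype.ext_iff.1 hx)]
    | puncture v hv => exact absurd hv (hlevel j _ hx)
    | lozenge l hl v w hv hw =>
      have h1 := (hnotup l hl x hv).1
      rw [← hx, hend] at h1
      exact absurd h1 (lt_irrefl _)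
  · have h := hf (.inl v)
    rw [Equiv.ofBijective_apply] at hvw
    rw [hvw] at h
    generalize hy : (Sum.inl w : p.hexPoints ⊕ Fin (p.C + p.M)) = y at h
    cases h with
    | finish j => cases hy
    | puncture _ _ => exact .inl (Sum.inl_injective hy).symm
    | lozenge l hl _ w' hv hw =>
      obtain rfl := Sum.inl_injective hy
      rcases (adjacent_iff (hloz l hl).1 (hloz l hl).2.1).1 (hloz l hl).2.2 with h1 | h1
      · exact .inl (Subtype.ext (by rw [← hv, ← hw, h1]))
      · rw [hv, hw] at h1
        exact .inr h1
  · have h := hf (.inl v)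
    rw [Equiv.ofBijective_apply]
    generalize f (.inl v) = y at h
    generalize hx : v = x at h
    cases h with
    | finish j =>
      have h1 := (hnotup l hl v hv).1
      rw [hx, hend] at h1
      exact absurd h1 (lt_irrefl _)
    | puncture v' hv' =>
      rw [← hx] at hv'
      exact absurd hv' (hnotup l hl v hv).2
    | lozenge l' hl' v' w' hv' hw' =>
      have h2 : l.1 = l'.1 :=
        mark_up_inj (hloz l hl).1 (hloz l' hl').1 (by rw [hv, hv', hx])
      obtain rfl : l = l' := (hup l.1 (hloz l hl).1).unique ⟨hl, rfl⟩ ⟨hl', h2.symm⟩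
      rw [Subtype.ext (hw'.symm.trans hw)]

section

variable {hp : p.Admissible} {τ : Perm (p.hexPoints ⊕ Fin (p.C + p.M))}

/-- No path of a routing enters the puncture: it could leave only across the edge of the puncture
on which all points are starting points. -/
theorem apply_of_inPuncture (hτ : IsRouting (startVertex hp) (endVertex hp) p.VertexStep τ)
    (v : p.hexPoints) (hv : p.InPuncture v.1) : τ (.inl v) = .inl v := by
  obtain ⟨k, hk⟩ : ∃ k : ℕ, (p.A : ℤ) - level v = k := ⟨(p.A - level v).toNat, by
    have := (mem_hexPoints.1 v.2).2.2.2
    unfold level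
    omega⟩
  induction k generalizing v with
  | zero =>
    unfold level at hk
    unfold InPuncture at hv
    omega
  | succ k ih =>
    rcases hw : τ (.inl v) with w | j
    · rcases hτ.moves v w hw with rfl | hstep
      · rfl
      exfalso
      have hl := Step.level hstep
      have hmono : v.1.1 ≤ w.1.1 ∧ w.1.2 ≤ v.1.2 := by
        rcases hstep with h | h <;> rw [h, Prod.fst_add, Prod.snd_add] <;> dsimp only <;> omega
      by_cases hedge : w.1.1 - w.1.2 = (p.A : ℤ) - p.γ
      · obtain ⟨i, hi⟩ := exists_startPt hp (v := w.1) (hv.1.trans hmono.1)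
          (by have := hv.2.1; omega) hedge
        have h1 := hτ.start i
        rw [show startVertex hp i = w from Subtype.ext hi.symm, ← hw] at h1
        cases τ.injective h1
      · have hwP : p.InPuncture w.1 := by
          unfold InPuncture at hv ⊢
          omega
        have h1 := ih w hwP (by unfold level at hk ⊢; omega)
        rw [← Sum.inl_injective (τ.injective (hw.trans h1.symm))] at hl
        omega
    · have h1 := hτ.finish j
      rw [← hw] at h1
      rw [← Sum.inl_injective (τ.injective h1)] at hv
      exact absurd hv (not_inPuncture_endPt j)

/-- A tiling is determined by a routing that follows its lozenges. -/
theorem Follows.mem_iff (hp : p.Admissible) {T : Finset Lozenge} (hT : T ∈ p.lozengeTilings)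
    (h : Follows T τ) {l : Lozenge} : l ∈ T ↔ l ∈ p.lozenges ∧
      ∀ v w : p.hexPoints, p.mark l.1 = v.1 → p.mark l.2 = w.1 → τ (.inl v) = .inl w := by
  obtain ⟨hsub, hup, -⟩ := mem_lozengeTilings.1 hT
  refine ⟨fun hl => ⟨hsub hl, h l hl⟩, ?_⟩
  rintro ⟨hl, hτl⟩
  obtain ⟨hl1, hl2, -⟩ := mem_lozenges.1 hl
  obtain ⟨l', ⟨hl', h1⟩, -⟩ := hup l.1 hl1
  have hl2' := (mem_lozenges.1 (hsub hl')).2.1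
  have e1 := hτl ⟨_, (mark_up hp hl1).1⟩ ⟨_, (mark_down hp hl2).1⟩ rfl rfl
  have e2 := h l' hl' ⟨_, (mark_up hp hl1).1⟩ ⟨_, (mark_down hp hl2').1⟩ (by rw [h1]) rfl
  have e3 := Subtype.ext_iff.1 (Sum.inl_injective (e1.symm.trans e2))
  have e4 : l.2 = l'.2 := mark_down_inj hl2 hl2' e3
  rwa [Prod.ext h1.symm e4]

/-- Every routing comes from a tiling, because it fixes the points inside the puncture. -/
theorem exists_tiling (hτ : IsRouting (startVertex hp) (endVertex hp) p.VertexStep τ) :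
    ∃ T ∈ p.lozengeTilings, Follows T τ := by
  classical
  have hnext : ∀ v w : p.hexPoints, τ (.inl v) = .inl w → v = w ∨ Step v.1 w.1 := hτ.moves
  refine ⟨p.lozenges.filter fun l => ∀ v w : p.hexPoints, p.mark l.1 = v.1 → p.mark l.2 = w.1 →
    τ (.inl v) = .inl w, mem_lozengeTilings.2 ⟨Finset.filter_subset _ _, fun m hm => ?_,
      fun n hn => ?_⟩, fun l hl => (Finset.mem_filter.1 hl).2⟩
  · obtain ⟨hmem, hA, hP⟩ := mark_up hp hm
    rcases hw : τ (.inl ⟨_, hmem⟩) with w | j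
    · -- the image of `m` is the mark of a downward triangle, since it is neither a starting
      -- point nor fixed in the puncture
      obtain ⟨n, hn, hnw⟩ := exists_down hp w.2 (fun hwP => by
          have h1 := apply_of_inPuncture hτ w hwP
          rw [← Sum.inl_injective (τ.injective (hw.trans h1.symm))] at hwP
          exact hP hwP) (fun i hi => by
          have h1 := hτ.start i
          rw [show startVertex hp i = w from Subtype.ext hi.symm, ← hw] at h1
          cases τ.injective h1)
      refine ⟨(m, n), ⟨Finset.mem_filter.2 ⟨mem_lozenges.2 ⟨hm, hn, ?_⟩, ?_⟩, rfl⟩, ?_⟩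
      · rw [adjacent_iff hm hn, hnw]
        rcases hnext _ _ hw with h | h
        · exact .inl (congrArg Subtype.val h)
        · exact .inr h
      · intro v' w' hv' hw'
        rw [show v' = ⟨_, hmem⟩ from Subtype.ext hv'.symm, hw, Subtype.ext (hnw.symm.trans hw')]
      · rintro ⟨m', n'⟩ ⟨hl, rfl⟩
        obtain ⟨hl1, hl2⟩ := Finset.mem_filter.1 hl
        have hn' := (mem_lozenges.1 hl1).2.1
        have h1 := hl2 ⟨_, hmem⟩ ⟨_, (mark_down hp hn').1⟩ rfl rfl
        rw [hw] at h1
        have h2 := Subtype.ext_iff.1 (Sum.inl_injective h1)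
        exact Prod.ext rfl (mark_down_inj hn' hn (h2.symm.trans hnw.symm))
    · have h1 := hτ.finish j
      rw [← hw] at h1
      have h2 := endPt_level j
      have h3 := congrArg Subtype.val (Sum.inl_injective (τ.injective h1))
      simp only [endVertex] at h3
      rw [h3] at h2
      omega
  · obtain ⟨hmem, hP, hs⟩ := mark_down hp hn
    obtain ⟨x, hx⟩ := τ.surjective (.inl ⟨_, hmem⟩)
    rcases x with v | i
    · -- the preimage of `n` is the mark of an upward triangle, for the analogous reason
      obtain ⟨m, hm, hmv⟩ := exists_up hp v.2 (lt_of_le_of_ne (mem_hexPoints.1 v.2).2.2.2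
          fun hA => by
            obtain ⟨j, hj⟩ := exists_endPt hp v.2 hA
            have h1 := hτ.finish j
            rw [show endVertex hp j = v from Subtype.ext hj.symm, hx] at h1
            cases h1) (fun hvP => by
          rw [apply_of_inPuncture hτ v hvP] at hx
          rw [Sum.inl_injective hx] at hvP
          exact hP hvP)
      refine ⟨(m, n), ⟨Finset.mem_filter.2 ⟨mem_lozenges.2 ⟨hm, hn, ?_⟩, ?_⟩, rfl⟩, ?_⟩
      · rw [adjacent_iff hm hn, hmv]
        rcases hnext _ _ hx with h | h
        · exact .inl (congrArg Subtype.val h)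
        · exact .inr h
      · intro v' w' hv' hw'
        rw [show v' = v from Subtype.ext (hv'.symm.trans hmv), hx]
        exact congrArg Sum.inl (Subtype.ext hw')
      · rintro ⟨m', n'⟩ ⟨hl, rfl⟩
        obtain ⟨hl1, hl2⟩ := Finset.mem_filter.1 hl
        have hm' := (mem_lozenges.1 hl1).1
        have h1 := hl2 ⟨_, (mark_up hp hm').1⟩ ⟨_, hmem⟩ rfl rfl
        have h2 := Subtype.ext_iff.1 (Sum.inl_injective (τ.injective (hx.trans h1.symm)))
        exact Prod.ext (mark_up_inj hm' hm (h2.symm.trans hmv.symm)) rfl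
    · rw [hτ.start] at hx
      exact absurd (congrArg Subtype.val (Sum.inl_injective hx)).symm (hs i)

/-- The segments drawn by a tiling are the moves of its routing. -/
theorem Follows.mem_segments_iff {T : Finset Lozenge} (hT : T ∈ p.lozengeTilings)
    (hτ : IsRouting (startVertex hp) (endVertex hp) p.VertexStep τ) (h : Follows T τ)
    {e : (ℤ × ℤ) × (ℤ × ℤ)} :
    e ∈ p.segments T ↔ ∃ v w : p.hexPoints, e = (v.1, w.1) ∧ Moves τ v w := by
  obtain ⟨hsub, hup, -⟩ := mem_lozengeTilings.1 hT
  constructor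
  · rintro ⟨l, hl, hne, rfl⟩
    obtain ⟨h1, h2, -⟩ := mem_lozenges.1 (hsub hl)
    exact ⟨⟨_, (mark_up hp h1).1⟩, ⟨_, (mark_down hp h2).1⟩, rfl, h l hl _ _ rfl rfl,
      fun h' => hne (congrArg Subtype.val h')⟩
  · rintro ⟨v, w, rfl, hvw, hne⟩
    have hP : ¬ p.InPuncture v.1 := by
      intro hP
      rw [apply_of_inPuncture hτ v hP] at hvw
      exact hne (Sum.inl_injective hvw)
    obtain ⟨m, hm, hmv⟩ := exists_up hp v.2 (lt_of_le_of_ne (mem_hexPoints.1 v.2).2.2.2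
      fun hA => by
        obtain ⟨j, hj⟩ := exists_endPt hp v.2 hA
        have h1 := hτ.finish j
        rw [show endVertex hp j = v from Subtype.ext hj.symm, hvw] at h1
        cases h1) hP
    obtain ⟨l, ⟨hl, rfl⟩, -⟩ := hup m hm
    have h2 := (mark_down hp (mem_lozenges.1 (hsub hl)).2.1).1
    have h3 := h l hl v ⟨_, h2⟩ hmv rfl
    rw [hvw] at h3
    have h4 : w.1 = p.mark l.2 := congrArg Subtype.val (Sum.inl_injective h3)
    refine ⟨l, hl, ?_, ?_⟩
    · rw [hmv, ← h4]
      exact fun h' => hne (Subtype.ext h')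
    · rw [hmv, ← h4]

theorem Follows.routing_unique {T : Finset Lozenge} (hT : T ∈ p.lozengeTilings)
    {ρ : Perm (p.hexPoints ⊕ Fin (p.C + p.M))}
    (hτ : IsRouting (startVertex hp) (endVertex hp) p.VertexStep τ)
    (hρ : IsRouting (startVertex hp) (endVertex hp) p.VertexStep ρ)
    (h : Follows T τ) (h' : Follows T ρ) : τ = ρ := by
  obtain ⟨hsub, hup, -⟩ := mem_lozengeTilings.1 hT
  ext1 x
  rcases x with v | i
  · by_cases hP : p.InPuncture v.1
    · rw [apply_of_inPuncture hτ v hP, apply_of_inPuncture hρ v hP]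
    rcases (mem_hexPoints.1 v.2).2.2.2.lt_or_eq with hA | hA
    · obtain ⟨m, hm, hmv⟩ := exists_up hp v.2 hA hP
      obtain ⟨l, ⟨hl, rfl⟩, -⟩ := hup m hm
      have h2 := (mark_down hp (mem_lozenges.1 (hsub hl)).2.1).1
      rw [h l hl v ⟨_, h2⟩ hmv rfl, h' l hl v ⟨_, h2⟩ hmv rfl]
    · obtain ⟨j, hj⟩ := exists_endPt hp v.2 hA
      obtain rfl : v = endVertex hp j := Subtype.ext hj
      rw [hτ.finish, hρ.finish]
  · rw [hτ.start, hρ.start]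

/-! ### The family of paths associated to a tiling -/

/-- The segments of a tiling form a functional relation that leads nowhere from an end point, so
they determine the path from each starting point. -/
theorem isAssociated_unique {T : Finset Lozenge} (hT : T ∈ p.lozengeTilings)
    (hτ : IsRouting (startVertex hp) (endVertex hp) p.VertexStep τ) (h : Follows T τ)
    {F G : p.PathFamily} (hF : p.IsAssociated T F) (hG : p.IsAssociated T G) : F = G := by
  have hchain : ∀ F : p.PathFamily, p.IsAssociated T F → ∀ i,
      (F.path i).IsChain fun P Q => (P, Q) ∈ p.segments T := by
    intro F hF i
    refine List.isChain_of_forall_mem_zip_tail fun e he => ?_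
    rw [← hF]
    exact ⟨i, he⟩
  have hfun : ∀ P Q Q', (P, Q) ∈ p.segments T → (P, Q') ∈ p.segments T → Q = Q' := by
    intro P Q Q' h1 h2
    obtain ⟨v, w, e1, hm1⟩ := (h.mem_segments_iff hT hτ).1 h1
    obtain ⟨v', w', e2, hm2⟩ := (h.mem_segments_iff hT hτ).1 h2
    rw [Prod.mk.injEq] at e1 e2
    obtain rfl : v = v' := Subtype.ext (e1.1.symm.trans e2.1)
    rw [e1.2, e2.2, Sum.inl_injective (hm1.1.symm.trans hm2.1)]
  have hend : ∀ j Q, (p.endPt j, Q) ∉ p.segments T := by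
    intro j Q h1
    obtain ⟨v, w, e1, hm⟩ := (h.mem_segments_iff hT hτ).1 h1
    rw [Prod.mk.injEq] at e1
    have h2 := hτ.finish j
    rw [show endVertex hp j = v from Subtype.ext e1.1, hm.1] at h2
    cases h2
  have hpath : ∀ i, F.path i = G.path i := fun i =>
    List.IsChain.eq_of_functional hfun (hchain F hF i) (hchain G hG i) (F.isLatticePath i).1
      (G.isLatticePath i).1 (F.isLatticePath i).2.1 (G.isLatticePath i).2.1 (hend _) (hend _)
  have hperm : F.perm = G.perm := by
    ext1 i
    have h1 := (F.isLatticePath i).2.1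
    rw [hpath i, (G.isLatticePath i).2.1] at h1
    exact (endPt_injective (Option.some_injective _ h1)).symm
  cases F
  cases G
  obtain rfl : _ = _ := hperm
  obtain rfl : _ = _ := funext hpath
  rfl

/-- The paths of the routing of a tiling form the associated family, and its sign is the Leibniz
term of the routing up to `(-1) ^ (C + M)`. -/
theorem exists_isAssociated {T : Finset Lozenge} (hT : T ∈ p.lozengeTilings)
    (hτ : IsRouting (startVertex hp) (endVertex hp) p.VertexStep τ) (h : Follows T τ) :
    ∃ F : p.PathFamily, p.IsAssociated T F ∧ (Perm.sign τ : ℤ) *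
      ∏ x, borderedMatrix (startVertex hp) (endVertex hp) (relMatrix p.VertexStep) x (τ x) =
        (-1) ^ (p.C + p.M) * F.sgn := by
  have hlevel : ∀ v w, p.VertexStep v w → level v < level w := fun v w => VertexStep.level_lt
  obtain ⟨σ, path, hhead, hlast, hchain, hdisj, hcover⟩ := hτ.exists_paths level hlevel
  refine ⟨⟨σ, fun i => (path i).map Subtype.val, fun i => ⟨?_, ?_, ?_⟩, fun i j hij => ?_⟩, ?_, ?_⟩
  · rw [List.head?_map, hhead]
    rfl
  · rw [List.getLast?_map, hlast]
    rfl
  · rw [List.isChain_map]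
    exact (hchain i).imp fun v w hm => (hτ.moves v w hm.1).resolve_left hm.2
  · intro P hP hP'
    obtain ⟨v, hv, rfl⟩ := List.mem_map.1 hP
    obtain ⟨w, hw, hwv⟩ := List.mem_map.1 hP'
    rw [Subtype.ext hwv] at hw
    exact hij (hdisj i j v hv hw)
  · ext e
    rw [h.mem_segments_iff hT hτ]
    simp only [PathFamily.steps, Set.mem_ofPred_eq, ← List.map_tail, List.zip_map,
      List.mem_map]
    constructor
    · rintro ⟨i, ⟨v, w⟩, hvw, rfl⟩
      exact ⟨v, w, rfl, (hchain i).rel_of_mem_zip_tail hvw⟩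
    · rintro ⟨v, w, rfl, hm⟩
      obtain ⟨i, hi⟩ := hcover v w hm
      exact ⟨i, (v, w), hi, rfl⟩
  · refine hτ.sign_mul_prod level hlevel σ path (fun i => List.mem_of_head? (hhead i))
      (fun i => List.mem_of_getLast? (hlast i)) hdisj (fun v w hm => ?_) fun i v hv => ?_
    · obtain ⟨i, hi⟩ := hcover v w hm
      exact ⟨i, (List.of_mem_zip hi).1, List.mem_of_mem_tail (List.of_mem_zip hi).2⟩
    · by_cases hve : v = endVertex hp (σ i)
      · exact .inl hve
      · obtain ⟨w, hw⟩ := List.exists_mem_zip_tail_of_ne_getLast (hlast i) hv hve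
        exact .inr ⟨w, List.mem_of_mem_tail (List.of_mem_zip hw).2,
          (hchain i).rel_of_mem_zip_tail hw⟩

end

end HexParams

theorem mainTheorem3 (p : HexParams) (hp : p.Admissible) :
    ∃ L : {T // T ∈ p.lozengeTilings} → p.PathFamily,
      (∀ (T : {T // T ∈ p.lozengeTilings}) (F : p.PathFamily),
        p.IsAssociated T F ↔ F = L T) ∧
      p.N.det = ∑ T : {T // T ∈ p.lozengeTilings}, (L T).sgn := by
  choose τ hτ hfollows using fun T : {T // T ∈ p.lozengeTilings} => HexParams.exists_routing hp T.2
  choose L hL hsign using fun T : {T // T ∈ p.lozengeTilings} =>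
    HexParams.exists_isAssociated T.2 (hτ T) (hfollows T)
  refine ⟨L, fun T F => ⟨fun hF =>
    HexParams.isAssociated_unique T.2 (hτ T) (hfollows T) hF (hL T), ?_⟩, ?_⟩
  · rintro rfl
    exact hL T
  rw [HexParams.det_N hp, ← Matrix.det_transpose, Matrix.det_apply', Finset.mul_sum]
  symm
  refine Finset.sum_of_injOn τ ?_ (fun _ _ => Finset.mem_coe.2 (Finset.mem_univ _)) ?_ ?_
  · intro T _ T' _ hTT'
    refine Subtype.ext (Finset.ext fun l => ?_)
    rw [(hfollows T).mem_iff hp T.2, (hfollows T').mem_iff hp T'.2, hTT']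
  · intro ρ _ hρ
    by_contra hne
    have hρ' : IsRouting (HexParams.startVertex hp) (HexParams.endVertex hp) p.VertexStep ρ := by
      refine isRouting_of_borderedMatrix_ne_zero fun x hx => hne ?_
      simp only [Matrix.transpose_apply]
      rw [Finset.prod_eq_zero (Finset.mem_univ x) hx, mul_zero, mul_zero]
    obtain ⟨T, hT, hTρ⟩ := HexParams.exists_tiling hρ'
    exact hρ ⟨⟨T, hT⟩, by simp, (hfollows ⟨T, hT⟩).routing_unique hT (hτ ⟨T, hT⟩) hρ' hTρ⟩
  · intro T _
    simp only [Matrix.transpose_apply, Int.cast_id]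
    rw [hsign T, ← mul_assoc, ← mul_pow]
    simp
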